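/- Let $\kappa$ be an uncountable regular cardinal. Two elements $p,q$ of a partial order $\mathbb{P}$ are compatible if there is $r\in\mathbb{P}$ with $r\leq p$ and $r\leq q$; an antichain is a set of pairwise incompatible elements. The partial order $\mathbb{P}$ is $\kappa$-Knaster if every subset of $\mathbb{P}$ of cardinality $\kappa$ has a subset of cardinality $\kappa$ consisting of pairwise compatible elements. A subset $\mathbb{Q}\subseteq\mathbb{P}$, with the induced order, is a regular suborder of $\mathbb{P}$ if elements of $\mathbb{Q}$ that are incompatible in $\mathbb{Q}$ are incompatible in $\mathbb{P}$, and every maximal antichain of $\mathbb{Q}$ is a maximal antichain of $\mathbb{P}$. Let $\mathcal{P}_\kappa(\mathbb{P})$ be the collection of all subsets of $\mathbb{P}$ of cardinality less than $\kappa$, and let $\mathrm{Reg}_\kappa(\mathbb{P})$ be the collection of all regular suborders of $\mathbb{P}$ of cardinality less than $\kappa$. The partial order $\mathbb{P}$ is $\kappa$-stationarily layered if $\mathrm{Reg}_\kappa(\mathbb{P})$ is stationary in $\mathcal{P}_\kappa(\mathbb{P})$ in the sense of Jech, i.e. it meets every $C\subseteq\mathcal{P}_\kappa(\mathbb{P})$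 that is $\subseteq$-cofinal in $\mathcal{P}_\kappa(\mathbb{P})$ and closed under unions of nonempty $\subseteq$-chains of fewer than $\kappa$ many elements of $C$. **Theorem.** Let $\kappa$ be an uncountable regular cardinal such that every $\kappa$-Knaster partial order of cardinality at most $\kappa$ is $\kappa$-stationarily layered. Then the following statements hold: (i) $\kappa$ is a Mahlo cardinal, i.e. $\kappa$ is strongly inaccessible and the set of regular cardinals below $\kappa$ is stationary in $\kappa$. (ii) Every stationary subset $S$ of $\kappa$ reflects, i.e. there is a limit ordinal $\alpha<\kappa$ such that $S\cap\alpha$ is stationary in $\alpha$ (it meets every closed unbounded subset of $\alpha$). -/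

import Mathlib

namespace LayeredPosets

universe u v

open Cardinal Ordinal

/-- Two conditions of a partial order are compatible if they have a common extension
(smaller elements are stronger). -/
def Compatible {P : Type u} [PartialOrder P] (p q : P) : Prop :=
  ∃ r : P, r ≤ p ∧ r ≤ q

/-- `P` is `κ`-Knaster: every set of `κ` many conditions has a subset of size `κ` that consists of
pairwise compatible conditions. -/
def IsKnaster (κ : Cardinal.{u}) (P : Type u) [PartialOrder P] : Prop :=
  ∀ A : Set P, #A = κ → ∃ B : Set P, B ⊆ A ∧ #B = κ ∧ B.Pairwise Compatible

/-- `Q ⊆ P` (with the induced order) is a regular suborder of `P`: conditions that are incompatible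
in `Q` are incompatible in `P`, and maximal antichains of `Q` are maximal antichains of `P`. Here,
`IsMaxAntichain Compatible A` says that `A` is maximal among the sets of pairwise
incompatible conditions. -/
def IsRegularSuborder {P : Type u} [PartialOrder P] (Q : Set P) : Prop :=
  (∀ p q : Q, ¬ Compatible p q → ¬ Compatible (p : P) (q : P)) ∧
    ∀ A : Set Q, IsMaxAntichain Compatible A →
      IsMaxAntichain Compatible ((fun q : Q => (q : P)) '' A)

/-- The collection of all subsets of `A` of cardinality less than `κ`. -/
def PKappa (κ : Cardinal.{u}) (A : Type u) : Set (Set A) :=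
  {a | #a < κ}

/-- The collection of all regular suborders of `P` of cardinality less than `κ`. -/
def Reg (κ : Cardinal.{u}) (P : Type u) [PartialOrder P] : Set (Set P) :=
  {Q | Q ∈ PKappa κ P ∧ IsRegularSuborder Q}

/-- `C` is a closed unbounded subset of `PKappa κ A`: it is `⊆`-cofinal, and it is continuous, i.e.
closed under unions of nonempty `⊆`-chains of fewer than `κ` many elements. -/
structure IsClubPKappa (κ : Cardinal.{u}) {A : Type u} (C : Set (Set A)) : Prop where
  subset : C ⊆ PKappa κ A
  cofinal : ∀ a ∈ PKappa κ A, ∃ c ∈ C, a ⊆ c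
  continuous : ∀ D : Set (Set A), D ⊆ C → D.Nonempty → IsChain (· ⊆ ·) D → #D < κ → ⋃₀ D ∈ C

/-- Jech's notion of stationarity in `PKappa κ A`. -/
def IsStationaryPKappa (κ : Cardinal.{u}) {A : Type u} (S : Set (Set A)) : Prop :=
  ∀ C : Set (Set A), IsClubPKappa κ C → (S ∩ C).Nonempty

/-- `P` is `κ`-stationarily layered. -/
def IsStationarilyLayered (κ : Cardinal.{u}) (P : Type u) [PartialOrder P] : Prop :=
  IsStationaryPKappa κ (Reg κ P)

/-- `S ∩ α` is stationary in the ordinal `α`: it meets every closed unbounded subset of `α`. -/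
def IsStationaryIn (α : Ordinal.{v}) (S : Set Ordinal.{v}) : Prop :=
  IsStationary {ξ : Set.Iio α | (ξ : Ordinal.{v}) ∈ S}

/-- The set `S` of ordinals below `κ` reflects: `S ∩ α` is stationary in `α` for some limit
ordinal `α < κ`. -/
def Reflects (κ : Cardinal.{v}) (S : Set Ordinal.{v}) : Prop :=
  ∃ α : Ordinal.{v}, α < κ.ord ∧ Order.IsSuccLimit α ∧ IsStationaryIn α S

/-- `κ` is a Mahlo cardinal: it is (strongly) inaccessible and the set of regular cardinals
below `κ` is stationary in `κ`. -/
def IsMahlo (κ : Cardinal.{v}) : Prop :=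
  κ.IsInaccessible ∧ IsStationaryIn κ.ord {α | ∃ μ : Cardinal.{v}, μ.IsRegular ∧ μ.ord = α}

end LayeredPosets

-- Each conclusion is proved by contraposition: its failure yields a Knaster order of size at most
-- `κ` that is not layered. Layeredness is refuted through reductions
-- (`IsRegularSuborder.exists_reduction`): a regular suborder taken from a suitable club would
-- contain a reduction of a chosen condition, yet that reduction has an extension inside the
-- suborder incompatible with the condition.
--
-- If `2 ^ μ ≥ κ` for some `μ < κ`, the order `Promise` does this: it has fewer than `κ` stems,
-- hence is Knaster, while a small suborder sees too few of the `κ` promises.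
--
-- Once `κ` is a strong limit, finite antichains in a tree of bounded subsets of `κ` under
-- end-extension are used; the strong limit property keeps the part of the tree below each height
-- small. The Knaster property comes from pressing down twice (`FinAntichain.isKnaster`).
-- Layeredness fails because a node cofinal in `α` has initial segments of heights cofinal in `α`.
-- For a nonreflecting `S`, nodes are bounded below the limit points of `S` that they pass, and
-- clubs avoiding `S` supply the cofinal nodes. For a club of singular ordinals, nodes have order
-- type below all their elements, and short cofinal sets supply the cofinal nodes.

universe u v

namespace LayeredPosets

open Cardinal Order Set

/-! ### Clubs, stationary sets and pressing down on a regular cardinal -/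

section RegularOrder

variable {K : Type u} [LinearOrder K]

theorem isSuccLimit_of_isLUB {d : Set K} (hd : d ⊆ {α | IsSuccLimit α}) (hne : d.Nonempty)
    {a : K} (ha : IsLUB d a) : IsSuccLimit a := by
  obtain ⟨c, hc⟩ := hne
  refine ⟨fun h => (hd hc).1 (h.mono (ha.1 hc)), fun b hb => ?_⟩
  obtain ⟨c', hc', hbc, -⟩ := ha.exists_between hb.lt
  rcases (ha.1 hc').lt_or_eq with h | h
  · exact hb.2 hbc h
  · subst h
    exact (hd hc').2 b hb

theorem _root_.Order.IsSuccLimit.exists_between {α γ : K} (hα : IsSuccLimit α) (hγ : γ < α) :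
    ∃ δ, γ < δ ∧ δ < α := by
  by_contra! h
  exact hα.2 γ ⟨hγ, fun c hc hca => (h c hc).not_gt hca⟩

theorem _root_.Order.IsSuccLimit.exists_lt {α : K} (hα : IsSuccLimit α) : ∃ δ, δ < α :=
  not_isMin_iff.1 hα.1

theorem _root_.IsStationary.isCofinal {S : Set K} (hS : IsStationary S) : IsCofinal S := fun x => by
  obtain ⟨y, hy, hxy⟩ := hS (t := Ici x)
    ⟨fun d hd ⟨c, hc⟩ _ a ha => (hd hc).trans (ha.1 hc),
      fun z => ⟨max x z, le_max_left _ _, le_max_right _ _⟩⟩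
  exact ⟨y, hy, hxy⟩

variable [WellFoundedLT K]

theorem exists_isLUB_of_forall_le {s : Set K} {b : K} (hb : ∀ x ∈ s, x ≤ b) : ∃ a, IsLUB s a :=
  ⟨WellFounded.min wellFounded_lt (upperBounds s) ⟨b, hb⟩, WellFounded.min_mem _ _ _,
    fun _ hc => WellFounded.min_le wellFounded_lt hc⟩

theorem exists_isLeast_strict_upper_bound {s : Set K} (hs : ∃ b, ∀ x ∈ s, x < b) :
    ∃ a, IsLeast {b | ∀ x ∈ s, x < b} a :=
  ⟨WellFounded.min wellFounded_lt {b | ∀ x ∈ s, x < b} hs, WellFounded.min_mem _ _ _,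
    fun _ hc => WellFounded.min_le wellFounded_lt hc⟩

variable [IsRegularCardinalOrder K]

theorem mk_Iio_lt_mk (i : K) : #(Iio i) < #K :=
  mk_Iio_lt i ord_cardinalMk

theorem exists_gt_of_mk_lt {s : Set K} (hs : #s < #K) : ∃ b, ∀ x ∈ s, x < b := by
  rw [← cof_eq_cardinalMk (α := K)] at hs
  exact not_isCofinal_iff.1 fun h => (cof_le h).not_gt hs

theorem isRegular_mk (hK : ℵ₀ ≤ #K) : (#K).IsRegular := by
  refine ⟨hK, ?_⟩
  rw [ord_cardinalMk, Ordinal.cof_type, cof_eq_cardinalMk]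

theorem cof_ne_aleph0 (hK : ℵ₀ < #K) : cof K ≠ ℵ₀ := by
  rw [cof_eq_cardinalMk]; exact hK.ne'

theorem exists_gt_of_aleph0_le (hK : ℵ₀ ≤ #K) (x : K) : ∃ y, x < y := by
  obtain ⟨b, hb⟩ := exists_gt_of_mk_lt (s := {x}) (by simpa using one_lt_aleph0.trans_le hK)
  exact ⟨b, hb x rfl⟩

theorem exists_isLUB_of_mk_lt {s : Set K} (hs : #s < #K) : ∃ a, IsLUB s a :=
  have ⟨_, hb⟩ := exists_gt_of_mk_lt hs
  exists_isLUB_of_forall_le fun x hx => (hb x hx).le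

/-- Iterating a function `ω` many times stays below a regular uncountable order. -/
theorem exists_iterate_isLUB (hK : ℵ₀ < #K) (f : K → K) (x : K) :
    ∃ β, IsLUB (range fun n : ℕ => f^[n] x) β :=
  exists_isLUB_of_mk_lt (((countable_range _).le_aleph0).trans_lt hK)

theorem isClub_setOf_isSuccLimit (hK : ℵ₀ < #K) : IsClub {α : K | IsSuccLimit α} := by
  refine ⟨fun d hd hne _ a ha => isSuccLimit_of_isLUB hd hne ha, fun x => ?_⟩
  choose f hf using exists_gt_of_aleph0_le hK.le
  obtain ⟨β, hβ⟩ := exists_iterate_isLUB hK f x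
  have hlt : ∀ n, f^[n] x < β := fun n =>
    (hf _).trans_le (by rw [← Function.iterate_succ_apply' f n x]; exact hβ.1 ⟨n + 1, rfl⟩)
  refine ⟨β, ⟨fun h => (h (hlt 0).le).not_gt (hlt 0), fun b hb => ?_⟩, (hlt 0).le⟩
  obtain ⟨_, ⟨n, rfl⟩, hbn, -⟩ := hβ.exists_between hb.lt
  exact hb.2 hbn (hlt n)

theorem isClub_setOf_gt {s : Set K} (hs : #s < #K) :
    IsClub {β : K | ∀ x ∈ s, x < β} := by
  refine ⟨fun d hd ⟨c, hc⟩ _ a ha x hx => (hd hc x hx).trans_le (ha.1 hc), fun x => ?_⟩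
  obtain ⟨b, hb⟩ := exists_gt_of_mk_lt hs
  exact ⟨max x b, fun y hy => (hb y hy).trans_le (le_max_right _ _), le_max_left _ _⟩

theorem _root_.IsStationary.inter_isClub (hK : ℵ₀ < #K) {S C : Set K} (hS : IsStationary S)
    (hC : IsClub C) : IsStationary (S ∩ C) := fun D hD => by
  rw [inter_assoc]
  exact hS (hC.inter (cof_ne_aleph0 hK) hD)

/-- The diagonal intersection of club sets is club. -/
theorem isClub_diagonal (hK : ℵ₀ < #K) {C : K → Set K} (hC : ∀ γ, IsClub (C γ)) :
    IsClub {β | ∀ γ < β, β ∈ C γ} := by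
  have tail {d : Set K} {a γ : K} (ha : IsLUB d a) (hγ : γ < a)
      (hd : ∀ c ∈ d, γ < c → c ∈ C γ) : a ∈ C γ := by
    obtain ⟨c₀, hc₀, hγc₀, -⟩ := ha.exists_between hγ
    refine (hC γ).isLUB_mem (t := {c ∈ d | γ < c}) (fun c hc => hd c hc.1 hc.2) ⟨c₀, hc₀, hγc₀⟩
      ⟨fun c hc => ha.1 hc.1, fun b hb => ha.2 fun c hc => ?_⟩
    rcases lt_or_ge γ c with h | h
    · exact hb ⟨hc, h⟩
    · exact h.trans (hγc₀.le.trans (hb ⟨hc₀, hγc₀⟩))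
  refine ⟨fun d hd _ _ a ha γ hγ => tail ha hγ fun c hc => hd hc γ, fun x => ?_⟩
  -- The supremum of `ω` iterates of this step works: the iterates past `γ` lie in `C γ`, apart from
  -- an initial part.
  have step (x : K) : ∃ y, x < y ∧ ∀ γ ≤ x, y ∈ C γ := by
    have hI : IsClub (⋂ γ : Iic x, C γ) := by
      refine IsClub.iInter (cof_ne_aleph0 hK) ?_ fun γ => hC γ
      obtain ⟨x', hx'⟩ := exists_gt_of_aleph0_le hK.le x
      rw [lift_lt, cof_eq_cardinalMk]
      exact (mk_le_mk_of_subset fun z (hz : z ≤ x) => hz.trans_lt hx').trans_lt (mk_Iio_lt_mk x')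
    obtain ⟨x', hx'⟩ := exists_gt_of_aleph0_le hK.le x
    obtain ⟨y, hy, hxy⟩ := hI.isCofinal x'
    exact ⟨y, hx'.trans_le hxy, fun γ hγ => mem_iInter.1 hy ⟨γ, hγ⟩⟩
  choose f hf hfC using step
  obtain ⟨β, hβ⟩ := exists_iterate_isLUB hK f x
  refine ⟨β, fun γ hγ => ?_, hβ.1 ⟨0, rfl⟩⟩
  obtain ⟨_, ⟨n, rfl⟩, hγn, -⟩ := hβ.exists_between hγ
  have hmono : StrictMono fun n : ℕ => f^[n] x := strictMono_nat_of_lt_succ fun n => by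
    rw [Function.iterate_succ_apply']; exact hf _
  refine (hC γ).isLUB_mem (t := (fun m : ℕ => f^[m] x) '' Ioi n) ?_ ⟨_, n + 1, by simp, rfl⟩ ⟨?_, ?_⟩
  · rintro _ ⟨m, hm, rfl⟩
    obtain ⟨k, rfl⟩ := Nat.exists_eq_succ_of_ne_zero (Nat.ne_zero_of_lt hm)
    simp only [Function.iterate_succ_apply']
    exact hfC _ _ (hγn.le.trans (hmono.monotone (Nat.lt_succ_iff.1 hm)))
  · rintro _ ⟨m, -, rfl⟩
    exact hβ.1 ⟨m, rfl⟩
  · refine fun b hb => hβ.2 ?_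
    rintro _ ⟨m, rfl⟩
    exact (hmono.monotone (le_max_left m (n + 1))).trans
      (hb ⟨max m (n + 1), (Nat.lt_succ_self n).trans_le (le_max_right _ _), rfl⟩)

/-- **Fodor's lemma**: a regressive function is constant on a stationary set. -/
theorem _root_.IsStationary.exists_const (hK : ℵ₀ < #K) {S : Set K} (hS : IsStationary S) {f : K → K}
    (hf : ∀ α ∈ S, f α < α) : ∃ γ, IsStationary {α ∈ S | f α = γ} := by
  by_contra! h
  simp_rw [not_isStationary_iff] at h
  choose C hC hdisj using h
  obtain ⟨α, hαS, hα⟩ := hS (isClub_diagonal hK hC)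
  exact disjoint_left.1 (hdisj (f α)) ⟨hαS, rfl⟩ (hα _ (hf α hαS))

theorem mk_finset_lt {A : Type u} {κ : Cardinal.{u}} (hκ : ℵ₀ < κ) (hA : #A < κ) :
    #(Finset A) < κ := by
  rcases finite_or_infinite A with h | h
  · exact (lt_aleph0_of_finite _).trans hκ
  · rwa [mk_finset_of_infinite]

/-- Fodor's lemma for functions whose values are finite sets. -/
theorem _root_.IsStationary.exists_const_finset (hK : ℵ₀ < #K) {S : Set K} (hS : IsStationary S)
    (hlim : ∀ α ∈ S, IsSuccLimit α) {f : K → Finset K} (hf : ∀ α ∈ S, ∀ x ∈ f α, x < α) :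
    ∃ H, IsStationary {α ∈ S | f α = H} := by
  have hbd (α : K) : ∃ γ, α ∈ S → γ < α ∧ ∀ x ∈ f α, x ≤ γ := by
    by_cases hα : α ∈ S
    swap
    · exact ⟨α, fun h => (hα h).elim⟩
    rcases (f α).eq_empty_or_nonempty with h | h
    · obtain ⟨γ, hγ⟩ := (hlim α hα).exists_lt
      exact ⟨γ, fun _ => ⟨hγ, by simp [h]⟩⟩
    · exact ⟨(f α).max' h, fun _ => ⟨hf α hα _ (Finset.max'_mem _ h), fun x hx => Finset.le_max' _ x hx⟩⟩
  choose g hg using hbd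
  obtain ⟨γ, hγ⟩ := hS.exists_const hK fun α hα => (hg α hα).1
  obtain ⟨γ', hγ'⟩ := exists_gt_of_aleph0_le hK.le γ
  -- All values now lie below the single point `γ'`, which has fewer than `#K` finite sets below it,
  -- so one of them occurs stationarily often.
  have hU : IsStationary (⋃ H : Finset (Iio γ'), {α ∈ S | f α = H.map (Function.Embedding.subtype _)}) := by
    refine hγ.mono fun α ⟨hαS, hα⟩ => mem_iUnion.2 ⟨(f α).subtype (· ∈ Iio γ'), hαS, ?_⟩
    rw [Finset.subtype_map_of_mem]
    exact fun x hx => (((hg α hαS).2 x hx).trans hα.le).trans_lt hγ'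
  rw [isStationary_iUnion_iff (cof_ne_aleph0 hK) (by
    rw [lift_lt, cof_eq_cardinalMk]; exact mk_finset_lt hK (mk_Iio_lt_mk γ'))] at hU
  obtain ⟨H, hH⟩ := hU
  exact ⟨_, hH⟩

end RegularOrder

/-! ### Reductions to regular suborders, and clubs of closed sets -/

theorem Compatible.symm {P : Type u} [PartialOrder P] {p q : P} (h : Compatible p q) :
    Compatible q p :=
  have ⟨r, hp, hq⟩ := h
  ⟨r, hq, hp⟩

/-- Every condition has a reduction to a regular suborder. -/
theorem IsRegularSuborder.exists_reduction {P : Type u} [PartialOrder P] {Q : Set P}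
    (hQ : IsRegularSuborder Q) (p : P) :
    ∃ q ∈ Q, ∀ r ∈ Q, r ≤ q → Compatible r p := by
  by_contra! h
  -- Take `A` maximal among the antichains of `Q` consisting of conditions incompatible with `p`.
  -- Without a reduction, every element of `Q` extends in `Q` to one incompatible with `p`, so `A`
  -- is a maximal antichain of `Q`, hence of `P`; this contradicts the choice of its elements.
  obtain ⟨A, hA⟩ := zorn_subset
    {A : Set Q | IsAntichain Compatible A ∧ ∀ r ∈ A, ¬ Compatible (r : P) p} (by
      intro c hc hchain
      refine ⟨⋃₀ c, ⟨?_, ?_⟩, fun s hs => subset_sUnion_of_mem hs⟩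
      · exact (pairwise_sUnion hchain.directedOn).2 fun s hs => (hc hs).1
      · rintro r ⟨s, hs, hr⟩
        exact (hc hs).2 r hr)
  have hmax : IsMaxAntichain Compatible A := by
    refine ⟨hA.prop.1, fun B hB hAB => hAB.antisymm fun b hb => ?_⟩
    by_contra hbA
    obtain ⟨r, hrQ, hrb, hrp⟩ := h b b.2
    have hins : insert (⟨r, hrQ⟩ : Q) A ⊆ A := by
      refine hA.le_of_ge ⟨?_, ?_⟩ (subset_insert _ _)
      · refine hA.prop.1.insert (fun a ha hne hc => ?_) (fun a ha hne hc => ?_)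
        all_goals
          have hab : Compatible a b := by
            obtain ⟨x, hx, hx'⟩ := hc
            first
              | exact ⟨x, hx, hx'.trans hrb⟩
              | exact ⟨x, hx', hx.trans hrb⟩
          exact hB (hAB ha) hb (fun he => hbA (he ▸ ha)) hab
      · rintro s (rfl | hs)
        · exact hrp
        · exact hA.prop.2 s hs
    have hrA := hins (mem_insert _ _)
    refine hB (hAB hrA) hb (fun he => hbA (he ▸ hrA)) ⟨⟨r, hrQ⟩, le_rfl, hrb⟩
  have hP := hQ.2 A hmax
  have hp : p ∈ (fun q : Q => (q : P)) '' A := by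
    rw [hP.2 (t := insert p ((fun q : Q => (q : P)) '' A)) _ (subset_insert _ _)]
    · exact mem_insert _ _
    · refine hP.1.insert ?_ ?_
      · rintro _ ⟨a, ha, rfl⟩ - hc
        exact hA.prop.2 a ha hc
      · rintro _ ⟨a, ha, rfl⟩ - hc
        exact hA.prop.2 a ha hc.symm
  obtain ⟨a, ha, rfl⟩ := hp
  exact hA.prop.2 a ha ⟨a, le_rfl, le_rfl⟩

/-- By `htrans`, closing a small set once under `f` already gives a closed set, so no iteration is
needed. -/
theorem isClubPKappa_of_closed {κ : Cardinal.{u}} (hκ : κ.IsRegular) {A : Type u}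
    {f : A → Set A} (hf : ∀ a, #(f a) < κ) (hmem : ∀ a, a ∈ f a)
    (htrans : ∀ a, ∀ b ∈ f a, f b ⊆ f a) :
    IsClubPKappa κ {C ∈ PKappa κ A | ∀ a ∈ C, f a ⊆ C} where
  subset := sep_subset _ _
  cofinal a ha := by
    refine ⟨⋃ x ∈ a, f x, ⟨?_, fun b hb => ?_⟩, fun x hx => mem_biUnion hx (hmem x)⟩
    · exact (card_biUnion_lt_iff_forall_of_isRegular hκ ha).2 fun x _ => hf x
    · obtain ⟨x, hx, hbx⟩ := mem_iUnion₂.1 hb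
      exact (htrans x b hbx).trans (subset_biUnion_of_mem (u := f) hx)
  continuous D hD _ _ hcard := by
    refine ⟨?_, ?_⟩
    · rw [sUnion_eq_biUnion]
      exact (card_biUnion_lt_iff_forall_of_isRegular hκ hcard).2 fun x hx => (hD hx).1
    · rintro a ⟨s, hs, has⟩
      exact ((hD hs).2 a has).trans (subset_sUnion_of_mem hs)

/-! ### Strong limit: forcing with finite promises -/

/-- Conditions for forcing a subset of `T` having finite intersection with the sets `b x`:
a finite approximation together with a finite set of promises. -/
@[ext]
structure Promise {T X : Type u} (b : X → Set T) where
  stem : Finset T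
  promises : Finset X

namespace Promise

variable {T X : Type u} {b : X → Set T}

instance : PartialOrder (Promise b) where
  le p q := q.stem ⊆ p.stem ∧ q.promises ⊆ p.promises ∧
    ∀ t ∈ p.stem, t ∉ q.stem → ∀ x ∈ q.promises, t ∉ b x
  le_refl p := ⟨subset_rfl, subset_rfl, fun t ht ht' => (ht' ht).elim⟩
  le_trans p q r hpq hqr := by
    refine ⟨hqr.1.trans hpq.1, hqr.2.1.trans hpq.2.1, fun t ht htr x hx => ?_⟩
    by_cases htq : t ∈ q.stem
    · exact hqr.2.2 t htq htr x hx
    · exact hpq.2.2 t ht htq x (hqr.2.1 hx)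
  le_antisymm p q hpq hqp :=
    Promise.ext (hqp.1.antisymm hpq.1) (hqp.2.1.antisymm hpq.2.1)

theorem compatible_of_stem_eq {p q : Promise b} (h : p.stem = q.stem) : Compatible p q := by
  classical
  refine ⟨⟨p.stem, p.promises ∪ q.promises⟩, ⟨subset_rfl, Finset.subset_union_left, ?_⟩,
    ⟨h.ge, Finset.subset_union_right, ?_⟩⟩
  · exact fun t ht ht' => (ht' ht).elim
  · exact fun t ht ht' => (ht' (h ▸ ht)).elim

theorem isKnaster {κ : Cardinal.{u}} (hκ : κ.IsRegular) (hT : #(Finset T) < κ) :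
    IsKnaster κ (Promise b) := by
  intro A hA
  obtain ⟨s, B, hB, hcard, hs⟩ := infinite_pigeonhole_set (s := A) (fun p => p.1.stem) κ hA.ge
    hκ.aleph0_le (hκ.cof_ord.symm ▸ hT)
  refine ⟨B, hB, ((mk_le_mk_of_subset hB).trans hA.le).antisymm hcard, fun p hp q hq _ => ?_⟩
  exact compatible_of_stem_eq ((hs hp).trans (hs hq).symm)

def equivProd : Promise b ≃ Finset T × Finset X where
  toFun p := (p.stem, p.promises)
  invFun p := ⟨p.1, p.2⟩
  left_inv _ := rfl
  right_inv _ := rfl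

theorem mk_le {κ : Cardinal.{u}} (hκ : ℵ₀ ≤ κ) (hT : #(Finset T) ≤ κ) (hX : #X ≤ κ) :
    #(Promise b) ≤ κ := by
  rw [mk_congr equivProd, mk_prod, lift_id, lift_id]
  refine mul_le_of_le hκ hT ?_
  rcases finite_or_infinite X with h | h
  · exact (lt_aleph0_of_finite _).le.trans hκ
  · rwa [mk_finset_of_infinite]

/-- A suborder of size less than `κ` omits some `x` from all its promises. If it is closed under
changing stems, a reduction of `⟨∅, {x}⟩` can be extended inside it by a point of `b x` that
respects the promises already made but violates `x`. -/
theorem not_isStationarilyLayered {κ : Cardinal.{u}} (hκ : ℵ₀ < κ) (hreg : κ.IsRegular)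
    (hT : #T < κ) (hX : κ ≤ #X)
    (hb : ∀ (A : Finset T) (F : Finset X), ∀ x ∉ F, ∃ t ∈ b x, t ∉ A ∧ ∀ y ∈ F, t ∉ b y) :
    ¬ IsStationarilyLayered κ (Promise b) := by
  classical
  intro hlay
  obtain ⟨Q, ⟨hQκ, hQ⟩, -, hclosed⟩ := hlay _ (isClubPKappa_of_closed hreg
    (f := fun p : Promise b => range fun s : Finset T => (⟨s, p.promises⟩ : Promise b))
    (fun p => mk_range_le.trans_lt (mk_finset_lt hκ hT)) (fun p => ⟨p.stem, rfl⟩)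
    (by rintro p _ ⟨s, rfl⟩ _ ⟨s', rfl⟩; exact ⟨s', rfl⟩))
  have hU : #(⋃ q ∈ Q, (q.promises : Set X)) < κ :=
    (card_biUnion_lt_iff_forall_of_isRegular hreg hQκ).2 fun q _ =>
      (lt_aleph0_iff_set_finite.2 q.promises.finite_toSet).trans hκ
  obtain ⟨x, hx⟩ : ∃ x, x ∉ ⋃ q ∈ Q, (q.promises : Set X) := by
    by_contra! h
    rw [eq_univ_of_forall h, mk_univ] at hU
    exact hU.not_ge hX
  obtain ⟨q, hqQ, hq⟩ := hQ.exists_reduction (⟨∅, {x}⟩ : Promise b)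
  obtain ⟨t, htx, htA, htF⟩ := hb q.stem q.promises x fun h => hx (mem_biUnion hqQ h)
  obtain ⟨r, hr, hr'⟩ := hq ⟨insert t q.stem, q.promises⟩ (hclosed q hqQ ⟨_, rfl⟩)
    ⟨Finset.subset_insert _ _, subset_rfl, fun t' ht' hne y hy => by
      rcases Finset.mem_insert.1 ht' with rfl | h
      · exact htF y hy
      · exact (hne h).elim⟩
  exact hr'.2.2 t (hr.1 (Finset.mem_insert_self _ _)) (Finset.notMem_empty _) x
    (Finset.mem_singleton_self _) htx

end Promise

/-- The pairs `(a, x ∩ a)` for finite `a`. For distinct sets `x`, `y`, every finite `a` that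
contains a point separating `x` from `y` gives different pairs. -/
def traces {Λ : Type u} (x : Set Λ) : Set (Finset Λ × Finset Λ) :=
  {t | (t.2 : Set Λ) = x ∩ t.1}

/-- The finite set `a` contains a point separating `x` from each member of `F`, plus a point `w`
outside every first coordinate in `A`, which makes the pair new. -/
theorem exists_mem_traces {Λ : Type u} [Infinite Λ] (A : Finset (Finset Λ × Finset Λ))
    {x : Set Λ} (F : Finset (Set Λ)) (hx : x ∉ F) :
    ∃ t ∈ traces x, t ∉ A ∧ ∀ y ∈ F, t ∉ traces y := by
  classical
  have hsep : ∀ y : Set Λ, ∃ z, y ≠ x → ¬ (z ∈ y ↔ z ∈ x) := fun y => by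
    by_contra! h
    exact (h (Classical.arbitrary Λ)).1 (Set.ext fun z => (h z).2)
  choose z hz using hsep
  obtain ⟨w, hw⟩ := Infinite.exists_notMem_finset (A.biUnion Prod.fst)
  let a : Finset Λ := insert w (F.image z)
  refine ⟨(a, a.filter (· ∈ x)), ?_, fun h => hw ?_, fun y hy h => ?_⟩
  · ext; simp [and_comm]
  · exact Finset.mem_biUnion.2 ⟨_, h, Finset.mem_insert_self _ _⟩
  · have hza : z y ∈ a := Finset.mem_insert_of_mem (Finset.mem_image_of_mem z hy)
    have := Set.ext_iff.1 h (z y)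
    simp only [Finset.coe_filter, mem_ofPred_eq, mem_inter_iff, Finset.mem_coe, hza, true_and,
      and_true] at this
    exact hz y (fun he => hx (he ▸ hy)) this.symm

theorem isStrongPrelimit_of_layered {κ : Cardinal.{u}} (hκ : ℵ₀ < κ) (hreg : κ.IsRegular)
    (hlayered : ∀ (P : Type u) [PartialOrder P], #P ≤ κ →
      IsKnaster κ P → IsStationarilyLayered κ P) : IsStrongPrelimit κ := by
  classical
  intro μ hμ
  induction μ using Cardinal.inductionOn with | _ Λ
  by_contra! h
  have hinf : Infinite Λ := by
    by_contra hfin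
    rw [not_infinite_iff_finite] at hfin
    exact ((power_lt_aleph0 (natCast_lt_aleph0 (n := 2)) (lt_aleph0_of_finite Λ)).trans
      hκ).not_ge (by simpa using h)
  rw [← mk_set, le_mk_iff_exists_set] at h
  obtain ⟨X, hX⟩ := h
  let b : X → Set (Finset Λ × Finset Λ) := fun x => traces (x : Set Λ)
  have hT : #(Finset Λ × Finset Λ) < κ := by
    simpa [mk_finset_of_infinite] using hμ
  refine Promise.not_isStationarilyLayered (b := b) hκ hreg hT hX.ge (fun A F x hx => ?_)
    (hlayered _ (Promise.mk_le hκ.le (mk_finset_lt hκ hT).le hX.le)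
      (Promise.isKnaster hreg (mk_finset_lt hκ hT)))
  obtain ⟨t, htx, htA, htF⟩ := exists_mem_traces A (x := x) (F.image Subtype.val) (by simpa using hx)
  exact ⟨t, htx, htA, fun y hy => htF y (Finset.mem_image_of_mem _ hy)⟩

/-! ### Finite antichains: Knaster property and failure of layeredness -/

/-- A version of the `Δ`-system lemma: among `κ` many finite sets, there are sets whose
intersection with a given small set is contained in a fixed proper subset. -/
theorem exists_root {T : Type u} {κ : Cardinal.{u}} (hκ : ℵ₀ < κ) (hreg : κ.IsRegular)
    {A : Set (Finset T)} (hA : κ ≤ #A) :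
    ∃ q : Finset T, ∀ W : Set T, #W < κ → ∃ p ∈ A, q ⊂ p ∧ ∀ u ∈ p, u ∈ W → u ∈ q := by
  classical
  obtain ⟨⟨n⟩, B, hBA, hB, hn⟩ := infinite_pigeonhole_set (s := A)
    (fun p => ULift.up.{u} p.1.card) κ hA hκ.le (by
      rw [hreg.cof_ord]; exact mk_le_aleph0.trans_lt hκ)
  replace hn : ∀ p ∈ B, p.card = n := fun p hp => ULift.up_injective (hn hp)
  -- A root of maximal size contained in `κ` many members: each point outside it can be added in
  -- fewer than `κ` of them, so fewer than `κ` of them meet `W` outside the root.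
  let M (k : ℕ) : Prop := ∃ q : Finset T, q.card = k ∧ κ ≤ #{p ∈ B | q ⊆ p}
  have hM0 : M 0 := ⟨∅, rfl, by simpa using hB⟩
  have hMn : ∀ k, M k → k ≤ n := by
    rintro _ ⟨q, rfl, hq⟩
    obtain ⟨p, hp, hqp⟩ : {p ∈ B | q ⊆ p}.Nonempty := by
      rw [nonempty_iff_ne_empty]
      intro h
      rw [h] at hq
      simpa using (aleph0_pos.trans hκ).trans_le hq
    exact (hn p hp) ▸ Finset.card_le_card hqp
  obtain ⟨q, hqk, hq⟩ : M (Nat.findGreatest M n) := Nat.findGreatest_spec (Nat.zero_le n) hM0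
  refine ⟨q, fun W hW => ?_⟩
  by_contra! hno
  have hcover : {p ∈ B | q ⊆ p} ⊆ {q} ∪ ⋃ u ∈ W \ q, {p ∈ B | insert u q ⊆ p} := by
    rintro p ⟨hp, hqp⟩
    rcases eq_or_ne p q with rfl | hne
    · exact Or.inl rfl
    · obtain ⟨u, hup, huW, huq⟩ := hno p (hBA hp) (hqp.ssubset_of_ne hne.symm)
      exact Or.inr (mem_biUnion (x := u) ⟨huW, huq⟩ ⟨hp, Finset.insert_subset hup hqp⟩)
  refine hq.not_gt ((mk_le_mk_of_subset hcover).trans_lt ((mk_union_le _ _).trans_lt ?_))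
  refine add_lt_of_lt hκ.le (by simpa using one_lt_aleph0.trans hκ) ?_
  refine (card_biUnion_lt_iff_forall_of_isRegular hreg
    ((mk_le_mk_of_subset sdiff_subset).trans_lt hW)).2 fun u hu => ?_
  by_contra! h
  have hMs : M (Nat.findGreatest M n + 1) :=
    ⟨insert u q, by rw [Finset.card_insert_of_notMem hu.2, hqk], h⟩
  exact (Nat.le_findGreatest (hMn _ hMs) hMs).not_gt (Nat.lt_succ_self _)

/-- The partial order of finite sets of pairwise `R`-unrelated points, ordered by reverse
inclusion. -/
@[ext]
structure FinAntichain {T : Type u} (R : T → T → Prop) : Type u where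
  carrier : Finset T
  not_rel : ∀ u ∈ carrier, ∀ v ∈ carrier, ¬ R u v

namespace FinAntichain

variable {T : Type u} {R : T → T → Prop}

instance : PartialOrder (FinAntichain R) where
  le p q := q.1 ⊆ p.1
  le_refl _ := subset_rfl
  le_trans _ _ _ hpq hqr := subset_trans hqr hpq
  le_antisymm _ _ hpq hqp := FinAntichain.ext (subset_antisymm hqp hpq)

theorem carrier_injective : Function.Injective (carrier : FinAntichain R → Finset T) :=
  fun _ _ => FinAntichain.ext

theorem compatible_of_forall {p q : FinAntichain R}
    (h : ∀ u ∈ p.1, ∀ v ∈ q.1, ¬ R u v ∧ ¬ R v u) : Compatible p q := by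
  classical
  refine ⟨⟨p.1 ∪ q.1, fun u hu v hv => ?_⟩, Finset.subset_union_left, Finset.subset_union_right⟩
  rcases Finset.mem_union.1 hu with hu | hu <;> rcases Finset.mem_union.1 hv with hv | hv
  · exact p.2 u hu v hv
  · exact (h u hu v hv).1
  · exact (h v hv u hu).2
  · exact q.2 u hu v hv

theorem _root_.LayeredPosets.Compatible.not_rel {p q : FinAntichain R} (h : Compatible p q) {u v : T}
    (hu : u ∈ p.1) (hv : v ∈ q.1) : ¬ R u v ∧ ¬ R v u :=
  have ⟨r, hp, hq⟩ := h
  ⟨r.2 u (hp hu) v (hq hv), r.2 v (hq hv) u (hp hu)⟩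

theorem mk_le {κ : Cardinal.{u}} (hκ : ℵ₀ ≤ κ) (hT : #T ≤ κ) : #(FinAntichain R) ≤ κ := by
  refine (mk_le_of_injective carrier_injective).trans ?_
  rcases finite_or_infinite T with h | h
  · exact (lt_aleph0_of_finite _).le.trans hκ
  · rwa [mk_finset_of_infinite]

variable {K : Type u} [LinearOrder K] [WellFoundedLT K] [IsRegularCardinalOrder K]

/-- The value `h α u` is a regressive code for a node `u` reaching above `α`; by `hbd`, a given code
occurs below a given `v` only for `α` bounded below `β`. Pressing down fixes the set `H` of codes,
then the set `G` of bounds, and indices above all of `G` give unrelated new parts. -/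
theorem isKnaster (hK : ℵ₀ < #K) {ρ : T → K} (hsmall : ∀ γ, #{u // ρ u < γ} < #K)
    (hρ : ∀ u v, R u v → ρ u ≤ ρ v) {E : Set K} (hE : IsStationary E)
    (hlim : ∀ α ∈ E, IsSuccLimit α) {h : K → T → K}
    (hreg : ∀ α ∈ E, ∀ u, α < ρ u → h α u < α)
    (hbd : ∀ β ∈ E, ∀ v, β < ρ v → ∀ o, ∃ γ < β, ∀ u, R u v → ρ u < β →
      ∀ α ∈ E, α < ρ u → h α u = o → α ≤ γ) :
    IsKnaster #K (FinAntichain R) := by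
  classical
  intro A hA
  obtain ⟨q, hq⟩ := exists_root hK (isRegular_mk hK.le) (A := carrier '' A)
    (by rw [mk_image_eq carrier_injective, hA])
  -- Strictness of the inclusion provides a point outside the root, which later makes `p` injective.
  have hp (α : K) : ∃ p ∈ A, q ⊂ p.1 ∧ ∀ u ∈ p.1, u ∉ q → α < ρ u := by
    obtain ⟨γ, hγ⟩ := exists_gt_of_aleph0_le hK.le α
    obtain ⟨_, ⟨p, hp, rfl⟩, hqp, h⟩ := hq {u | ρ u < γ} (hsmall γ)
    exact ⟨p, hp, hqp, fun u hu huq => hγ.trans_le (not_lt.1 fun hlt => huq (h u hu hlt))⟩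
  choose p hpA hqp hpρ using hp
  have hC : IsClub {β | ∀ α < β, ∀ u ∈ (p α).1, ρ u < β} := by
    have := isClub_diagonal hK (C := fun α => {β | ∀ x ∈ ρ '' (p α).1, x < β}) fun α =>
      isClub_setOf_gt ((lt_aleph0_iff_set_finite.2 ((p α).1.finite_toSet.image ρ)).trans hK)
    simpa using! this
  obtain ⟨H, hH⟩ := (hE.inter_isClub hK hC).exists_const_finset hK (fun α hα => hlim α hα.1)
    (f := fun α => ((p α).1 \ q).image (h α)) (by
      intro α hα x hx
      obtain ⟨u, hu, rfl⟩ := Finset.mem_image.1 hx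
      rw [Finset.mem_sdiff] at hu
      exact hreg α hα.1 u (hpρ α u hu.1 hu.2))
  choose! g hgβ hg using hbd
  obtain ⟨G, hG⟩ := hH.exists_const_finset hK (fun α hα => hlim α hα.1.1)
    (f := fun β => (((p β).1 \ q) ×ˢ H).image fun x => g β x.1 x.2) (by
      intro β hβ x hx
      obtain ⟨⟨v, o⟩, hv, rfl⟩ := Finset.mem_image.1 hx
      rw [Finset.mem_product, Finset.mem_sdiff] at hv
      exact hgβ β hβ.1.1 v (hpρ β v hv.1.1 hv.1.2) o)
  have hF := hG.inter_isClub hK (isClub_setOf_gt (s := (G : Set K))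
    ((lt_aleph0_iff_set_finite.2 G.finite_toSet).trans hK))
  set F := {β ∈ {α ∈ E ∩ {β | ∀ α < β, ∀ u ∈ (p α).1, ρ u < β} |
    ((p α).1 \ q).image (h α) = H} | (((p β).1 \ q) ×ˢ H).image (fun x => g β x.1 x.2) = G} ∩
      {β | ∀ x ∈ (G : Set K), x < β}
  have key : ∀ α ∈ F, ∀ β ∈ F, α < β → ∀ u ∈ (p α).1, u ∉ q → ∀ v ∈ (p β).1, v ∉ q →
      ρ u < ρ v ∧ ¬ R u v := by
    rintro α ⟨⟨⟨⟨hαE, hαC⟩, hαH⟩, -⟩, hαG⟩ β ⟨⟨⟨⟨hβE, hβC⟩, -⟩, hβG⟩, -⟩ hαβ u hu huq v hv hvq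
    have hu' := hpρ α u hu huq
    have hv' := hpρ β v hv hvq
    have huβ := hβC α hαβ u hu
    refine ⟨huβ.trans hv', fun hR => ?_⟩
    have ho : h α u ∈ H := hαH ▸ Finset.mem_image_of_mem _ (Finset.mem_sdiff.2 ⟨hu, huq⟩)
    have hgG : g β v (h α u) ∈ G := hβG ▸ Finset.mem_image.2
      ⟨(v, h α u), Finset.mem_product.2 ⟨Finset.mem_sdiff.2 ⟨hv, hvq⟩, ho⟩, rfl⟩
    exact (hg β hβE v hv' _ u hR huβ α hαE hu' rfl).not_gt (hαG _ hgG)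
  have hcomp : ∀ α ∈ F, ∀ β ∈ F, α < β → Compatible (p α) (p β) := by
    intro α hα β hβ hαβ
    refine compatible_of_forall fun u hu v hv => ?_
    by_cases huq : u ∈ q
    · have hu' := (hqp β).1 huq
      exact ⟨(p β).2 u hu' v hv, (p β).2 v hv u hu'⟩
    by_cases hvq : v ∈ q
    · have hv' := (hqp α).1 hvq
      exact ⟨(p α).2 u hu v hv', (p α).2 v hv' u hu⟩
    have := key α hα β hβ hαβ u hu huq v hv hvq
    exact ⟨this.2, fun hR => (hρ _ _ hR).not_gt this.1⟩
  have hinj : InjOn p F := by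
    have hne : ∀ α ∈ F, ∀ β ∈ F, α < β → p α ≠ p β := by
      intro α hα β hβ hαβ he
      obtain ⟨u, hu, huq⟩ := Finset.exists_of_ssubset (hqp α)
      exact (key α hα β hβ hαβ u hu huq u (he ▸ hu) huq).1.ne rfl
    intro α hα β hβ he
    by_contra hαβ
    rcases lt_or_gt_of_ne hαβ with hlt | hlt
    · exact hne _ hα _ hβ hlt he
    · exact hne _ hβ _ hα hlt he.symm
  refine ⟨p '' F, image_subset_iff.2 fun α _ => hpA α, ?_, ?_⟩
  · rw [mk_image_eq_of_injOn _ _ hinj]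
    exact (mk_set_le _).antisymm (cof_eq_cardinalMk (α := K) ▸ cof_le hF.isCofinal)
  · rintro _ ⟨α, hα, rfl⟩ _ ⟨β, hβ, rfl⟩ hne
    rcases lt_or_gt_of_ne (ne_of_apply_ne p hne) with hlt | hlt
    · exact hcomp α hα β hβ hlt
    · exact (hcomp β hβ α hα hlt).symm

/-- Some `L α` with `α ∈ D` would be regular. Let `q` be a reduction of `{t}` and `s` a node below
`t`, higher than all of `q`. Then `s` is below no node of `q`, and a node of `q` below `s` would be
below `t`; so `s` can be added to `q`, contradicting compatibility with `{t}`. -/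
theorem not_isStationarilyLayered (hK : ℵ₀ < #K) {ρ : T → K}
    (hsmall : ∀ γ, #{u // ρ u < γ} < #K) (hρ : ∀ u v, R u v → ρ u ≤ ρ v)
    (htrans : ∀ u v w, R u v → R v w → R u w) (hirrefl : ∀ u, ¬ R u u)
    {D : Set K} (hD : IsClub D) (hlim : ∀ α ∈ D, IsSuccLimit α)
    (hex : ∀ α ∈ D, ∃ t, ∀ γ < α, ∃ s, R s t ∧ γ < ρ s ∧ ρ s < α) :
    ¬ IsStationarilyLayered #K (FinAntichain R) := by
  classical
  intro hlay
  let L (α : K) : Set (FinAntichain R) := {p | ∀ u ∈ p.1, ρ u < α}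
  have hL (α : K) : #(L α) < #K := by
    refine lt_of_le_of_lt ?_ (mk_finset_lt hK (hsmall α))
    refine mk_le_of_injective (f := fun p : L α => p.1.1.subtype (ρ · < α)) fun p p' he => ?_
    have := congrArg (Finset.map (Function.Embedding.subtype _)) he
    simp only at this
    rw [Finset.subtype_map_of_mem p.2, Finset.subtype_map_of_mem p'.2] at this
    exact Subtype.ext (FinAntichain.ext this)
  have hclub : IsClubPKappa #K (L '' D) := by
    refine ⟨?_, fun a ha => ?_, fun X hX hne _ hcard => ?_⟩
    · rintro _ ⟨α, -, rfl⟩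
      exact hL α
    · have hU : #(⋃ p ∈ a, ρ '' (p.1 : Set T)) < #K :=
        (card_biUnion_lt_iff_forall_of_isRegular (isRegular_mk hK.le) ha).2 fun p _ =>
          (lt_aleph0_iff_set_finite.2 (p.1.finite_toSet.image ρ)).trans hK
      obtain ⟨b, hb⟩ := exists_gt_of_mk_lt hU
      obtain ⟨α, hα, hbα⟩ := hD.isCofinal b
      exact ⟨L α, ⟨α, hα, rfl⟩, fun p hp u hu =>
        (hb _ (mem_biUnion hp (mem_image_of_mem ρ hu))).trans_le hbα⟩
    · have : Nonempty K := mk_ne_zero_iff.1 (aleph0_pos.trans hK).ne'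
      choose! f hfD hfL using hX
      obtain ⟨α, hα⟩ := exists_isLUB_of_mk_lt (mk_image_le (f := f) (s := X) |>.trans_lt hcard)
      refine ⟨α, hD.isLUB_mem (image_subset_iff.2 hfD) (hne.image f) hα, ?_⟩
      ext p
      refine ⟨fun hp => ?_, fun ⟨s, hs, hps⟩ u hu => ?_⟩
      · rcases p.1.eq_empty_or_nonempty with h | h
        · obtain ⟨s, hs⟩ := hne
          refine ⟨s, hs, ?_⟩
          rw [← hfL hs]
          intro u hu
          simp [h] at hu
        · obtain ⟨u, hu, hmax⟩ := Finset.exists_max_image p.1 ρ h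
          obtain ⟨_, ⟨s, hs, rfl⟩, hlt, -⟩ := hα.exists_between (hp u hu)
          refine ⟨s, hs, ?_⟩
          rw [← hfL hs]
          exact fun v hv => (hmax v hv).trans_lt hlt
      · rw [← hfL hs] at hps
        exact (hps u hu).trans_le (hα.1 (mem_image_of_mem f hs))
  obtain ⟨_, ⟨-, hreg⟩, α, hα, rfl⟩ := hlay _ hclub
  obtain ⟨t, ht⟩ := hex α hα
  obtain ⟨q, hqL, hq⟩ := hreg.exists_reduction
    (⟨{t}, by simpa using hirrefl t⟩ : FinAntichain R)
  obtain ⟨γ, hγα, hγ⟩ : ∃ γ < α, ∀ u ∈ q.1, ρ u ≤ γ := by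
    rcases q.1.eq_empty_or_nonempty with h | h
    · obtain ⟨γ, hγ⟩ := (hlim α hα).exists_lt
      exact ⟨γ, hγ, by simp [h]⟩
    · obtain ⟨u, hu, hmax⟩ := Finset.exists_max_image q.1 ρ h
      exact ⟨ρ u, hqL u hu, hmax⟩
  obtain ⟨s, hst, hγs, hsα⟩ := ht γ hγα
  have hqt := hq q hqL le_rfl
  have hsq : ∀ u ∈ q.1, ¬ R u s ∧ ¬ R s u := fun u hu =>
    ⟨fun h => (hqt.not_rel hu (Finset.mem_singleton_self t)).1 (htrans _ _ _ h hst),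
      fun h => ((hρ _ _ h).trans (hγ u hu)).not_gt hγs⟩
  let r : FinAntichain R := ⟨insert s q.1, by
    intro u hu v hv
    rcases Finset.mem_insert.1 hu with rfl | hu' <;> rcases Finset.mem_insert.1 hv with rfl | hv'
    · exact hirrefl _
    · exact (hsq v hv').2
    · exact (hsq u hu').1
    · exact q.2 u hu' v hv'⟩
  have hr : r ∈ L α := fun u hu => by
    rcases Finset.mem_insert.1 hu with rfl | hu
    · exact hsα
    · exact hqL u hu
  exact ((hq r hr (Finset.subset_insert _ _)).not_rel (Finset.mem_insert_self s _)
    (Finset.mem_singleton_self t)).1 hst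

end FinAntichain

/-! ### Trees of bounded sets under end-extension -/

/-- `d` is a proper end-extension of `c`. -/
def ProperEndExt {K : Type u} [LinearOrder K] (c d : Set K) : Prop :=
  c ⊂ d ∧ ∀ x ∈ d, ∀ y ∈ c, x ≤ y → x ∈ c

theorem ProperEndExt.trans {K : Type u} [LinearOrder K] {c d e : Set K} (h : ProperEndExt c d)
    (h' : ProperEndExt d e) : ProperEndExt c e :=
  ⟨h.1.trans h'.1, fun x hx y hy hxy => h.2 x (h'.2 x hx y (h.1.1 hy) hxy) y hy hxy⟩

section Trees

variable {K : Type u} [LinearOrder K] [WellFoundedLT K]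

theorem type_lt_of_properEndExt {u v : Set K} (h : ProperEndExt u v) :
    Ordinal.type (α := u) (· < ·) < Ordinal.type (α := v) (· < ·) := by
  obtain ⟨z, hzv, hzu⟩ := exists_of_ssubset h.1
  have hlt : ∀ y ∈ u, y < z := fun y hy => lt_of_not_ge fun hle => hzu (h.2 z hzv y hy hle)
  refine lt_of_le_of_lt ?_ (Ordinal.typein_lt_type (α := v) (· < ·) ⟨z, hzv⟩)
  rw [← Ordinal.type_Iio_lt]
  exact Ordinal.type_le_iff'.2 ⟨.ofMonotone
    (fun y => (⟨⟨y, h.1.1 y.2⟩, hlt y y.2⟩ : Iio (⟨z, hzv⟩ : v))) fun _ _ hab => hab⟩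

theorem type_le_of_subset {u v : Set K} (h : u ⊆ v) :
    Ordinal.type (α := u) (· < ·) ≤ Ordinal.type (α := v) (· < ·) :=
  Ordinal.type_le_iff'.2 ⟨.ofMonotone (inclusion h) fun _ _ hab => hab⟩

/-- Initial segments of `v` are comparable, and a proper one has smaller order type. -/
theorem subset_of_type_eq {u u' v : Set K} (hu : ProperEndExt u v) (hu' : ProperEndExt u' v)
    (he : Ordinal.type (α := u) (· < ·) = Ordinal.type (α := u') (· < ·)) : u ⊆ u' := by
  by_contra hss
  obtain ⟨x, hx, hxu'⟩ := not_subset.1 hss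
  have hsub : u' ⊂ u := by
    refine ⟨fun y hy => ?_, hss⟩
    rcases le_total x y with hxy | hxy
    · exact (hxu' (hu'.2 x (hu.1.1 hx) y hy hxy)).elim
    · exact hu.2 y (hu'.1.1 hy) x hx hxy
  exact (type_lt_of_properEndExt ⟨hsub, fun a ha b hb hab => hu'.2 a (hu.1.1 ha) b hb hab⟩).ne' he

variable [IsRegularCardinalOrder K]

/-- The forcing used to refute layeredness: its conditions are finite antichains in a tree of
bounded subsets of `K` ordered by end-extension. -/
theorem exists_isKnaster_not_isStationarilyLayered (hK : ℵ₀ < #K) (hsl : IsStrongPrelimit #K)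
    {Q : Set K → Prop} (hQ : ∀ c x, Q c → Q (c ∩ Iio x))
    {D : Set K} (hD : IsClub D) (hDlim : ∀ α ∈ D, IsSuccLimit α)
    (hex : ∀ α ∈ D, ∃ t ⊆ Iio α, (∀ γ < α, ∃ x ∈ t, γ < x) ∧ Q t)
    {E : Set K} (hE : IsStationary E) (hElim : ∀ α ∈ E, IsSuccLimit α) {h : K → Set K → K}
    (hreg : ∀ α ∈ E, ∀ u, Q u → (∃ x ∈ u, α ≤ x) → h α u < α)
    (hbd : ∀ β ∈ E, ∀ v, Q v → (∃ y ∈ v, β ≤ y) → ∀ o, ∃ γ < β, ∀ u, ProperEndExt u v → Q u →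
      (∃ δ < β, ∀ x ∈ u, x < δ) → ∀ α ∈ E, (∃ x ∈ u, α ≤ x) → h α u = o → α ≤ γ) :
    ∃ (P : Type u) (_ : PartialOrder P), #P ≤ #K ∧ IsKnaster #K P ∧
      ¬ IsStationarilyLayered #K P := by
  let T : Type u := {c : Set K // (∃ b, ∀ x ∈ c, x < b) ∧ Q c}
  let R : T → T → Prop := fun c d => ProperEndExt c.1 d.1
  choose ρ hρ using fun c : T => exists_isLeast_strict_upper_bound c.2.1
  have hρlt {c : T} {x : K} (hx : x ∈ c.1) : x < ρ c := (hρ c).1 x hx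
  have hρle {c : T} {b : K} (hb : ∀ x ∈ c.1, x < b) : ρ c ≤ b := (hρ c).2 hb
  have hρgt {c : T} {b : K} (hb : b < ρ c) : ∃ x ∈ c.1, b ≤ x := by
    by_contra! hlt
    exact (hρle hlt).not_gt hb
  have hmono : ∀ u v, R u v → ρ u ≤ ρ v := fun u v huv => hρle fun x hx => hρlt (huv.1.1 hx)
  have hsmall : ∀ γ, #{u // ρ u < γ} < #K := fun γ => by
    refine lt_of_le_of_lt ?_ (hsl (mk_Iio_lt_mk γ))
    rw [← mk_set]
    refine mk_le_of_injective (f := fun u : {u // ρ u < γ} => Subtype.val ⁻¹' u.1.1)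
      fun u v huv => Subtype.ext (Subtype.ext ?_)
    have hu : u.1.1 ⊆ Iio γ := fun x hx => (hρlt hx).trans u.2
    have hv : v.1.1 ⊆ Iio γ := fun x hx => (hρlt hx).trans v.2
    exact (Subtype.preimage_val_eq_preimage_val_iff _ _ _).1 huv |> fun h => by
      rwa [inter_eq_right.2 hu, inter_eq_right.2 hv] at h
  have hT : #T ≤ #K := by
    have hcover : (univ : Set T) ⊆ ⋃ γ : K, {u | ρ u < γ} := fun u _ =>
      mem_iUnion.2 (exists_gt_of_aleph0_le hK.le (ρ u))
    rw [← mk_univ]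
    refine (mk_le_mk_of_subset hcover).trans ((mk_iUnion_le _).trans ?_)
    exact mul_le_of_le hK.le le_rfl (ciSup_le' fun γ => (hsmall γ).le)
  refine ⟨FinAntichain R, inferInstance, FinAntichain.mk_le hK.le hT,
    FinAntichain.isKnaster hK hsmall hmono hE hElim (h := fun α u => h α u.1) ?_ ?_,
    FinAntichain.not_isStationarilyLayered hK hsmall hmono ?_ ?_ hD hDlim ?_⟩
  · exact fun α hα u hu => hreg α hα u.1 u.2.2 (hρgt hu)
  · intro β hβ v hv o
    obtain ⟨γ, hγβ, hγ⟩ := hbd β hβ v.1 v.2.2 (hρgt hv) o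
    exact ⟨γ, hγβ, fun u huv hu α hα hαu ho =>
      hγ u.1 huv u.2.2 ⟨ρ u, hu, fun x => hρlt⟩ α hα (hρgt hαu) ho⟩
  · exact fun _ _ _ => ProperEndExt.trans
  · exact fun u hu => hu.1.ne rfl
  · intro α hα
    obtain ⟨t, htα, hcof, htQ⟩ := hex α hα
    refine ⟨⟨t, ⟨α, htα⟩, htQ⟩, fun γ hγ => ?_⟩
    -- Two points of `t` are needed: `x` lifts the segment above `γ`, and `y` cuts it off, making it
    -- proper.
    obtain ⟨x, hxt, hγx⟩ := hcof γ hγ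
    obtain ⟨y, hyt, hxy⟩ := hcof x (htα hxt)
    refine ⟨⟨t ∩ Iio y, ⟨y, fun z hz => hz.2⟩, hQ t y htQ⟩, ⟨⟨inter_subset_left, fun hss => ?_⟩, ?_⟩, ?_, ?_⟩
    · exact lt_irrefl y (hss hyt).2
    · exact fun z hz w hw hzw => ⟨hz, hzw.trans_lt hw.2⟩
    · exact hγx.trans (hρlt ⟨hxt, hxy⟩)
    · refine (hρle ?_).trans_lt (htα hyt)
      exact fun z hz => hz.2

/-- A set that does not reflect yields a Knaster partial order that is not layered. -/
theorem exists_of_nonreflecting (hK : ℵ₀ < #K) (hsl : IsStrongPrelimit #K) {S : Set K}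
    (hS : IsStationary S)
    (hex : ∀ α, IsSuccLimit α → ∃ t ⊆ Iio α, (∀ γ < α, ∃ x ∈ t, γ < x) ∧
      ∀ δ ∈ S, δ < α → IsSuccLimit δ → ∃ γ < δ, ∀ x ∈ t, x < δ → x ≤ γ) :
    ∃ (P : Type u) (_ : PartialOrder P), #P ≤ #K ∧ IsKnaster #K P ∧
      ¬ IsStationarilyLayered #K P := by
  have hlim := isClub_setOf_isSuccLimit hK
  have : Nonempty K := mk_ne_zero_iff.1 (aleph0_pos.trans hK).ne'
  obtain ⟨k, hk⟩ : ∃ k : K, ∀ x, k ≤ x := ⟨WellFounded.min wellFounded_lt univ univ_nonempty,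
    fun x => WellFounded.min_le _ (mem_univ x)⟩
  -- A constant code suffices: if `v` reaches past `β ∈ S`, then `v` is bounded below `β`, and this
  -- bounds every `α` reached by a segment inside `β`.
  refine exists_isKnaster_not_isStationarilyLayered hK hsl
    (Q := fun c => ∀ δ ∈ S, IsSuccLimit δ → (∃ y ∈ c, δ ≤ y) → ∃ γ < δ, ∀ x ∈ c, x < δ → x ≤ γ)
    ?_ hlim (fun _ => id) ?_ (hS.inter_isClub hK hlim) (fun α hα => hα.2) (h := fun _ _ => k)
    ?_ ?_
  · rintro c x hc δ hδ hδl ⟨y, hy, hδy⟩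
    obtain ⟨γ, hγδ, hγ⟩ := hc δ hδ hδl ⟨y, hy.1, hδy⟩
    exact ⟨γ, hγδ, fun z hz => hγ z hz.1⟩
  · intro α hα
    obtain ⟨t, htα, hcof, ht⟩ := hex α hα
    exact ⟨t, htα, hcof, fun δ hδ hδl ⟨y, hy, hδy⟩ => ht δ hδ (hδy.trans_lt (htα hy)) hδl⟩
  · rintro α ⟨-, hα⟩ - - -
    obtain ⟨γ, hγ⟩ := hα.exists_lt
    exact (hk γ).trans_lt hγ
  · rintro β ⟨hβ, hβl⟩ v hv hy -
    obtain ⟨γ, hγβ, hγ⟩ := hv β hβ hβl hy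
    refine ⟨γ, hγβ, fun u huv _ ⟨δ, hδβ, hδ⟩ α _ ⟨x, hx, hαx⟩ _ => ?_⟩
    exact hαx.trans (hγ x (huv.1.1 hx) ((hδ x hx).trans hδβ))

/-- A club set of singular limit points yields a Knaster partial order that is not layered. -/
theorem exists_of_club_singular (hK : ℵ₀ < #K) (hsl : IsStrongPrelimit #K) {D : Set K}
    (hD : IsClub D)
    (hsing : ∀ α ∈ D, IsSuccLimit α →
      (cof (Iio α)).ord < Ordinal.typein (α := K) (· < ·) α) :
    ∃ (P : Type u) (_ : PartialOrder P), #P ≤ #K ∧ IsKnaster #K P ∧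
      ¬ IsStationarilyLayered #K P := by
  classical
  have hlim := isClub_setOf_isSuccLimit hK
  have : Nonempty K := mk_ne_zero_iff.1 (aleph0_pos.trans hK).ne'
  have hτ (u : Set K) : ∃ k : K, Ordinal.type (α := u) (· < ·) < Ordinal.type (α := K) (· < ·) →
      Ordinal.typein (α := K) (· < ·) k = Ordinal.type (α := u) (· < ·) := by
    by_cases hu : Ordinal.type (α := u) (· < ·) < Ordinal.type (α := K) (· < ·)
    · obtain ⟨k, hk⟩ := Ordinal.typein_surj (α := K) (· < ·) hu
      exact ⟨k, fun _ => hk⟩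
    · exact ⟨Classical.arbitrary K, fun h => (hu h).elim⟩
  choose τ hτ using hτ
  let k : K := WellFounded.min wellFounded_lt univ univ_nonempty
  have hk : ∀ x, k ≤ x := fun x => WellFounded.min_le _ (mem_univ x)
  let Q : Set K → Prop := fun c => ∀ x ∈ c,
    Ordinal.type (α := c) (· < ·) < Ordinal.typein (α := K) (· < ·) x
  have hQτ {u : Set K} (hu : Q u) {x : K} (hx : x ∈ u) :
      Ordinal.typein (α := K) (· < ·) (τ u) = Ordinal.type (α := u) (· < ·) :=
    hτ u ((hu x hx).trans (Ordinal.typein_lt_type _ _))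
  -- The order type of a node is below each of its elements, so it is a regressive code when some
  -- element is below `α`; otherwise the code is the least point `k`.
  refine exists_isKnaster_not_isStationarilyLayered hK hsl (Q := Q)
    ?_ (hD.inter (cof_ne_aleph0 hK) hlim) (fun _ h => h.2) ?_
    (hlim.isStationary (cof_ne_aleph0 hK)) (fun α hα => hα)
    (h := fun α u => if ∃ x ∈ u, x < α then τ u else k) ?_ ?_
  · exact fun c x hc y hy => (type_le_of_subset inter_subset_left).trans_lt (hc y hy.1)
  · rintro α ⟨hαD, hα⟩
    obtain ⟨κ, hκ⟩ := Ordinal.typein_surj (α := K) (· < ·)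
      ((hsing α hαD hα).trans (Ordinal.typein_lt_type _ _))
    have hκα : κ < α := by
      rw [← Ordinal.typein_lt_typein (α := K) (· < ·), hκ]
      exact hsing α hαD hα
    obtain ⟨s, hs, hstype⟩ := Ordinal.exists_ord_cof_eq (α := Iio α)
    -- Here `κ` is the point of `K` whose rank is the cofinality of `α`. Dropping everything up to
    -- it puts all remaining elements above the order type.
    refine ⟨{x | κ < x ∧ ∃ y ∈ s, (y : K) = x}, ?_, fun γ hγ => ?_, ?_⟩
    · rintro _ ⟨-, y, -, rfl⟩
      exact y.2
    · obtain ⟨δ, hδ, hδα⟩ := hα.exists_between (max_lt hγ hκα)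
      obtain ⟨y, hys, hy⟩ := hs ⟨δ, hδα⟩
      have hδy : δ ≤ (y : K) := hy
      exact ⟨y, ⟨((le_max_right _ _).trans_lt hδ).trans_le hδy, y, hys, rfl⟩,
        ((le_max_left _ _).trans_lt hδ).trans_le hδy⟩
    · rintro x ⟨hx, -⟩
      refine lt_of_le_of_lt ?_ ((Ordinal.typein_lt_typein (α := K) (· < ·)).2 hx)
      rw [hκ, ← hstype]
      choose f hfs hf using fun x : {x | κ < x ∧ ∃ y ∈ s, (y : K) = x} => x.2.2
      refine (RelEmbedding.ofMonotone (fun x => (⟨f x, hfs x⟩ : s)) fun a b hab => ?_).ordinal_type_le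
      change (f a : K) < f b
      rwa [hf, hf]
  · rintro α hα u hu -
    split_ifs with hx
    · obtain ⟨x, hxu, hxα⟩ := hx
      refine lt_trans ?_ hxα
      rw [← Ordinal.typein_lt_typein (α := K) (· < ·), hQτ hu hxu]
      exact hu x hxu
    · obtain ⟨γ, hγ⟩ := hα.exists_lt
      exact (hk γ).trans_lt hγ
  · intro β hβ v hv _ o
    -- At most one nonempty segment of `v` has code `o` as its order type, and segments considered
    -- here are bounded below `β`.
    obtain ⟨γ₁, hγ₁β, hγ₁⟩ : ∃ γ < β, ∀ u, ProperEndExt u v → Q u → (∃ δ < β, ∀ x ∈ u, x < δ) →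
        ∀ x ∈ u, τ u = o → x ≤ γ := by
      by_cases h₀ : ∃ u, ProperEndExt u v ∧ Q u ∧ (∃ δ < β, ∀ x ∈ u, x < δ) ∧ u.Nonempty ∧ τ u = o
      · obtain ⟨u₀, hu₀v, hu₀, ⟨δ, hδβ, hδ⟩, ⟨y, hy⟩, ho⟩ := h₀
        refine ⟨δ, hδβ, fun u huv hu _ x hx hτu => (hδ x ?_).le⟩
        refine subset_of_type_eq huv hu₀v ?_ hx
        rw [← hQτ hu hx, ← hQτ hu₀ hy, hτu, ho]
      · obtain ⟨γ, hγ⟩ := hβ.exists_lt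
        exact ⟨γ, hγ, fun u huv hu hδ x hx hτu => (h₀ ⟨u, huv, hu, hδ, ⟨x, hx⟩, hτu⟩).elim⟩
    -- For the default code, `u` has no element below `α`, so it is enough that all nonempty
    -- segments of `v` inside `β` have an element below a common bound.
    obtain ⟨γ₂, hγ₂β, hγ₂⟩ : ∃ γ < β, ∀ u, ProperEndExt u v → (∀ x ∈ u, x < β) → u.Nonempty →
        ∃ x ∈ u, x ≤ γ := by
      by_cases h₀ : ∃ y ∈ v, y < β
      · obtain ⟨y, hyv, hyβ⟩ := h₀
        refine ⟨y, hyβ, fun u huv _ ⟨x, hx⟩ => ?_⟩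
        rcases le_total x y with hxy | hxy
        · exact ⟨x, hx, hxy⟩
        · exact ⟨y, huv.2 y hyv x hx hxy, le_rfl⟩
      · obtain ⟨γ, hγ⟩ := hβ.exists_lt
        exact ⟨γ, hγ, fun u huv hu ⟨x, hx⟩ => (h₀ ⟨x, huv.1.1 hx, hu x hx⟩).elim⟩
    refine ⟨max γ₁ γ₂, max_lt hγ₁β hγ₂β, fun u huv hu hδ α _ ⟨x, hx, hαx⟩ ho => ?_⟩
    split_ifs at ho with hmin
    · exact (hαx.trans (hγ₁ u huv hu hδ x hx ho)).trans (le_max_left _ _)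
    · obtain ⟨δ, hδβ, hδ⟩ := hδ
      obtain ⟨y, hy, hyγ⟩ := hγ₂ u huv (fun x hx => (hδ x hx).trans hδβ) ⟨x, hx⟩
      push Not at hmin
      exact ((hmin y hy).trans hyγ).trans (le_max_right _ _)

end Trees

/-! ### Transfer to ordinals and conclusion -/

theorem _root_.IsClub.preimage_orderIso {A : Type u} {B : Type v} [LinearOrder A] [LinearOrder B]
    (e : A ≃o B) {s : Set B} (hs : IsClub s) : IsClub (e ⁻¹' s) := by
  refine ⟨fun d hd hne _ a ha => ?_, fun x => ?_⟩
  · exact hs.isLUB_mem (t := e '' d) (image_subset_iff.2 hd) (hne.image e) (e.isLUB_image'.2 ha)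
  · obtain ⟨y, hy, hxy⟩ := hs.isCofinal (e x)
    exact ⟨e.symm y, by simpa using hy, e.le_symm_apply.2 hxy⟩

theorem _root_.IsStationary.preimage_orderIso {A : Type u} {B : Type v} [LinearOrder A]
    [LinearOrder B] (e : A ≃o B) {s : Set B} (hs : IsStationary s) : IsStationary (e ⁻¹' s) := by
  intro D hD
  obtain ⟨b, hb, hbD⟩ := hs (hD.preimage_orderIso e.symm)
  exact ⟨e.symm b, by simpa using hb, hbD⟩

theorem isRegularCardinalOrder_toType {κ : Cardinal.{u}} (hκ : κ.IsRegular) :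
    IsRegularCardinalOrder κ.ord.ToType :=
  ⟨by simp [hκ.cof_ord]⟩

theorem aleph0_le_cof_Iio {K : Type u} [LinearOrder K] {α : K}
    (hα : IsSuccLimit α) : ℵ₀ ≤ cof (Iio α) := by
  have : Nonempty (Iio α) := let ⟨γ, hγ⟩ := hα.exists_lt; ⟨⟨γ, hγ⟩⟩
  have : NoMaxOrder (Iio α) := ⟨fun γ =>
    let ⟨δ, hγδ, hδ⟩ := hα.exists_between γ.2
    ⟨⟨δ, hδ⟩, hγδ⟩⟩
  exact aleph0_le_cof

theorem isSuccLimit_typein {K : Type u} [LinearOrder K] [WellFoundedLT K] {α : K}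
    (hα : IsSuccLimit α) : IsSuccLimit (Ordinal.typein (α := K) (· < ·) α) := by
  rw [← Ordinal.one_lt_cof_iff, ← Order.cof_Iio]
  exact one_lt_aleph0.trans_le (aleph0_le_cof_Iio hα)

/-- A limit ordinal equal to its own cofinality would be a regular cardinal. -/
theorem ord_cof_Iio_lt_typein {K : Type u} [LinearOrder K] [WellFoundedLT K] {α : K}
    (hα : IsSuccLimit α)
    (hsing : ∀ μ : Cardinal.{u}, μ.IsRegular → μ.ord ≠ Ordinal.typein (α := K) (· < ·) α) :
    (cof (Iio α)).ord < Ordinal.typein (α := K) (· < ·) α := by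
  rw [Order.cof_Iio]
  exact (Ordinal.ord_cof_le _).lt_of_ne (hsing _ (isRegular_cof (isSuccLimit_typein hα)))

theorem isMahlo_and_reflects_of_layered (κ : Cardinal.{u}) (huncountable : ℵ₀ < κ)
    (hregular : κ.IsRegular)
    (hlayered : ∀ (P : Type u) [PartialOrder P], #P ≤ κ →
      IsKnaster κ P → IsStationarilyLayered κ P) :
    IsMahlo κ ∧ ∀ S : Set Ordinal.{u}, S ⊆ Set.Iio κ.ord → IsStationaryIn κ.ord S → Reflects κ S := by
  have hinst := isRegularCardinalOrder_toType hregular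
  have hcard : #κ.ord.ToType = κ := mk_ord_toType κ
  have hK : ℵ₀ < #κ.ord.ToType := hcard.symm ▸ huncountable
  have hslκ := isStrongPrelimit_of_layered huncountable hregular hlayered
  have hsl : IsStrongPrelimit #κ.ord.ToType := hcard.symm ▸ hslκ
  have hnot : ¬ ∃ (P : Type u) (_ : PartialOrder P), #P ≤ #κ.ord.ToType ∧
      IsKnaster #κ.ord.ToType P ∧ ¬ IsStationarilyLayered #κ.ord.ToType P := by
    rintro ⟨P, _, hP, hkn, hnl⟩
    rw [hcard] at hP hkn hnl
    exact hnl (hlayered P hP hkn)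
  let e : Set.Iio κ.ord ≃o κ.ord.ToType := Ordinal.ToType.mk
  have he (α : κ.ord.ToType) : Ordinal.typein (α := κ.ord.ToType) (· < ·) α = e.symm α := rfl
  refine ⟨⟨⟨huncountable, hregular.2, hslκ⟩, ?_⟩, fun S _ hS => ?_⟩
  · by_contra hns
    obtain ⟨C, hC, hdisj⟩ := not_isStationary_iff.1 hns
    refine hnot (exists_of_club_singular hK hsl (hC.preimage_orderIso e.symm) fun α hαC hα => ?_)
    exact ord_cof_Iio_lt_typein hα fun μ hμ hμα => disjoint_left.1 hdisj ⟨μ, hμ, hμα⟩ hαC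
  · by_contra hno
    refine hnot (exists_of_nonreflecting hK hsl (hS.preimage_orderIso e.symm) fun α hα => ?_)
    have hns : ¬ IsStationaryIn (e.symm α : Ordinal.{u}) S := fun h =>
      hno ⟨_, (e.symm α).2, he α ▸ isSuccLimit_typein hα, h⟩
    obtain ⟨C, hC, hdisj⟩ := not_isStationary_iff.1 hns
    refine ⟨{x | ∃ h : (e.symm x : Ordinal.{u}) < e.symm α,
      (⟨e.symm x, h⟩ : Set.Iio (e.symm α : Ordinal.{u})) ∈ C}, fun x ⟨h, _⟩ => ?_,
      fun γ hγ => ?_, fun δ hδS hδα hδ => ?_⟩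
    · exact e.symm.lt_iff_lt.1 h
    · obtain ⟨δ, hγδ, hδα⟩ := hα.exists_between hγ
      obtain ⟨c, hcC, hδc⟩ := hC.isCofinal ⟨e.symm δ, e.symm.lt_iff_lt.2 hδα⟩
      have hc : (c : Ordinal.{u}) < κ.ord := lt_trans c.2 (e.symm α).2
      have hx : e.symm (e ⟨c, hc⟩) = ⟨c, hc⟩ := e.symm_apply_apply _
      refine ⟨e ⟨c, hc⟩, ⟨(congrArg Subtype.val hx).trans_lt c.2, ?_⟩,
        hγδ.trans_le (e.symm_apply_le.1 hδc)⟩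
      convert hcC
      exact Subtype.ext (show (e.symm (e ⟨c, hc⟩) : Ordinal.{u}) = c by rw [hx])
    · by_contra! hunb
      let δ' : Set.Iio (e.symm α : Ordinal.{u}) := ⟨e.symm δ, e.symm.lt_iff_lt.2 hδα⟩
      -- If `C` were unbounded below `δ`, closure would put `δ` into both `C` and `S`.
      suffices hδC : δ' ∈ C from Set.disjoint_left.1 hdisj hδS hδC
      refine hC.isLUB_mem (t := {c ∈ C | c < δ'}) (fun c hc => hc.1) ?_
        ⟨fun c hc => hc.2.le, fun b hb => ?_⟩
      · obtain ⟨γ, hγ⟩ := hδ.exists_lt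
        obtain ⟨x, ⟨hx, hxC⟩, hxδ, -⟩ := hunb γ hγ
        exact ⟨_, hxC, e.symm.lt_iff_lt.2 hxδ⟩
      · by_contra! hbδ
        have hbκ : (b : Ordinal.{u}) < κ.ord := lt_trans b.2 (e.symm α).2
        obtain ⟨x, ⟨hx, hxC⟩, hxδ, hbx⟩ := hunb (e ⟨b, hbκ⟩) (e.lt_symm_apply.1 hbδ)
        exact (hb ⟨hxC, e.symm.lt_iff_lt.2 hxδ⟩).not_gt (e.lt_symm_apply.2 hbx)

end LayeredPosets

theorem theorem1p8 (κ : Cardinal.{u}) (huncountable : Cardinal.aleph0 < κ) (hregular : κ.IsRegular)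
    (hlayered : ∀ (P : Type u) [PartialOrder P], Cardinal.mk P ≤ κ →
      LayeredPosets.IsKnaster κ P → LayeredPosets.IsStationarilyLayered κ P) :
    LayeredPosets.IsMahlo κ ∧
      ∀ S : Set Ordinal.{u}, S ⊆ Set.Iio κ.ord → LayeredPosets.IsStationaryIn κ.ord S →
        LayeredPosets.Reflects κ S :=
  LayeredPosets.isMahlo_and_reflects_of_layered κ huncountable hregular hlayered
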